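/- Let $M$ be a compact oriented smooth Riemannian manifold of dimension $n\ge 1$, possibly with boundary, with metric $\langle\cdot,\cdot\rangle$, Riemannian volume form $\mathrm{vol}$ and Hodge star $*$ (normalised by $\beta\wedge *\alpha=\langle\beta,\alpha\rangle\,\mathrm{vol}$, $*1=\mathrm{vol}$), and let $\Omega^k(M)$ be the space of smooth $k$-forms. For $\mu\in\Omega^n(M)$ regard $*\mu$ as a function. For a functional $F$ on $\Omega^k(M)$ and $a\in\Omega^k(M)$, the variational derivative $\delta_aF$ is the element $e\in\Omega^{n-k}(M)$ such that $\frac{d}{d\varepsilon}\big|_{\varepsilon=0}F(a+\varepsilon\,\delta a)=\int_M\delta a\wedge e$ for all $\delta a\in\Omega^k(M)$. For $\alpha\in\Omega^1(M)$ and $\mu\in\Omega^n(M)$ with $*\mu$ nowhere zero, let the kinetic energy in momentum variables be $H_k(\alpha,\mu)=\int_M\frac{1}{2(*\mu)}\,\alpha\wedge*\alpha$. The change of variables $\Phi(\alpha,\mu)=(\tilde v,\mu):=\big(\frac{\alpha}{*\mu},\mu\big)$ is a bijection of the set of pairs $(\alpha,\mu)\in\Omega^1(M)\times\Omega^n(M)$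 with $*\mu$ nowhere zero onto itself, and in the velocity variables $(\tilde v,\mu)$ the kinetic energy is $$H_k(\tilde v,\mu)=\int_M\tfrac12(*\mu)\,\tilde v\wedge*\tilde v,$$ that is, $H_k(\alpha,\mu)=\int_M\tfrac12(*\mu)\,\tilde v\wedge*\tilde v$ whenever $(\tilde v,\mu)=\Phi(\alpha,\mu)$. For all $\tilde v\in\Omega^1(M)$ and $\mu\in\Omega^n(M)$, the variational derivatives $\delta_{\tilde v}H_k\in\Omega^{n-1}(M)$ and $\delta_\mu H_k\in\Omega^0(M)$ of the functional $H_k(\tilde v,\mu)=\int_M\tfrac12(*\mu)\,\tilde v\wedge*\tilde v$ exist, are unique, and are given by $$\delta_{\tilde v}H_k=(*\mu)*\tilde v=\iota_v\mu,\qquad \delta_\mu H_k=\tfrac12\,\iota_v\tilde v,$$ where $v$ is the vector field with $\tilde v=\langle v,\cdot\rangle$. -/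

import Mathlib

open scoped Manifold ContDiff Topology Bundle
open Module MeasureTheory Bundle

/-! ### Linear algebra of alternating forms -/

section LinearAlgebra

variable {V : Type*}

/-- The wedge product `α ∧ β` of alternating forms on `V`, as a form of degree `p = k + l`; it is
the sum over `(k, l)`-shuffles, so that `(dx ∧ dy) (∂x, ∂y) = 1`. -/
noncomputable def altWedge [AddCommGroup V] [Module ℝ V] {k l p : ℕ} (h : k + l = p)
    (α : V [⋀^Fin k]→ₗ[ℝ] ℝ) (β : V [⋀^Fin l]→ₗ[ℝ] ℝ) : V [⋀^Fin p]→ₗ[ℝ] ℝ :=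
  ((LinearMap.mul' ℝ ℝ).compAlternatingMap (α.domCoprod β)).domDomCongr
    (finSumFinEquiv.trans (finCongr h))

theorem append_update_right {k l : ℕ} (u : Fin k → V) (w : Fin l → V) [DecidableEq (Fin l)]
    (i : Fin l) (z : V) :
    Fin.append u (Function.update w i z)
      = Function.update (Fin.append u w) (Fin.natAdd k i) z := by
  ext j
  refine Fin.addCases (fun a => ?_) (fun b => ?_) j
  · have : Fin.castAdd l a ≠ Fin.natAdd k i := by
      intro hh
      have := congrArg Fin.val hh
      simp at this
      omega
    simp [Function.update_of_ne this]
  · by_cases hb : b = i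
    · subst hb
      simp
    · have : Fin.natAdd k b ≠ Fin.natAdd k i := fun hh => hb (by simpa using hh)
      rw [Function.update_of_ne this, Fin.append_right, Fin.append_right,
        Function.update_of_ne hb]

/-- Insert the vectors `u` into the first `k` slots of a form of degree `n = k + l`:
`w ↦ η (u₁, …, u_k, w₁, …, w_l)`. -/
def altInsert [AddCommGroup V] [Module ℝ V] {k l n : ℕ} (h : k + l = n)
    (η : V [⋀^Fin n]→ₗ[ℝ] ℝ) (u : Fin k → V) : V [⋀^Fin l]→ₗ[ℝ] ℝ where
  toFun w := η.domDomCongr (finCongr h.symm) (Fin.append u w)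
  map_update_add' w i x y := by
    simp only [append_update_right, AlternatingMap.map_update_add]
  map_update_smul' w i c x := by
    simp only [append_update_right, AlternatingMap.map_update_smul]
  map_eq_zero_of_eq' w i j hw hij := by
    refine AlternatingMap.map_eq_zero_of_eq _ _ (i := Fin.natAdd k i) (j := Fin.natAdd k j)
      (by simpa using hw) (fun hh => hij (by simpa using hh))

/-- The Hodge star of an oriented inner product space of dimension `n = k + l`:
`(*α) (w₁, …, w_l) = (1 / k!) ∑ α (e_{i₁}, …, e_{i_k}) vol (e_{i₁}, …, e_{i_k}, w₁, …, w_l)`, the sum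
being over all `k`-tuples of vectors of an orthonormal basis `e`. This is the convention
`β ∧ *α = ⟨β, α⟩ vol`, with `*1 = vol`. -/
noncomputable def altHodge [NormedAddCommGroup V] [InnerProductSpace ℝ V] [FiniteDimensional ℝ V]
    {n : ℕ} [Fact (finrank ℝ V = n)] (o : Orientation ℝ V (Fin n)) {k l : ℕ} (h : k + l = n)
    (α : V [⋀^Fin k]→ₗ[ℝ] ℝ) : V [⋀^Fin l]→ₗ[ℝ] ℝ :=
  ((k.factorial : ℝ)⁻¹) • ∑ J : Fin k → Fin (finrank ℝ V),
    α (fun a => stdOrthonormalBasis ℝ V (J a)) •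
      altInsert h o.volumeForm (fun a => stdOrthonormalBasis ℝ V (J a))

end LinearAlgebra

/-! ### Differential forms on a manifold -/

section Manifold

variable {n : ℕ} {H : Type*} [TopologicalSpace H]
  (I : ModelWithCorners ℝ (EuclideanSpace ℝ (Fin n)) H)
  (M : Type*) [TopologicalSpace M] [ChartedSpace H M]

instance tangentSpace_finiteDimensional (x : M) : FiniteDimensional ℝ (TangentSpace I x) :=
  inferInstanceAs (FiniteDimensional ℝ (EuclideanSpace ℝ (Fin n)))

instance tangentSpace_fact_finrank (x : M) : Fact (finrank ℝ (TangentSpace I x) = n) :=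
  ⟨(finrank_euclideanSpace_fin : finrank ℝ (EuclideanSpace ℝ (Fin n)) = n)⟩

/-- Differential `k`-forms on `M`; no regularity is included (see `IsSmoothForm`). -/
abbrev DForm (k : ℕ) : Type _ := ∀ x : M, TangentSpace I x [⋀^Fin k]→ₗ[ℝ] ℝ

variable {M} [IsManifold I ∞ M]

/-- The coordinate frame `∂₁, …, ∂ₙ` at `x` of the chart around `c` (meaningful for `x` in the
domain of that chart): the images of the standard basis vectors under the inverse of the
differential of the chart. -/
noncomputable def coordFrame (c x : M) (j : Fin n) : TangentSpace I x :=
  (trivializationAt (EuclideanSpace ℝ (Fin n)) (TangentSpace I : M → Type _) c).symmL ℝ x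
    (EuclideanSpace.basisFun (Fin n) ℝ j)

variable {I}

/-- A form is smooth if its components in every chart are smooth functions. -/
def IsSmoothForm {k : ℕ} (η : DForm I M k) : Prop :=
  ∀ (c : M) (J : Fin k → Fin n),
    ContMDiffOn I 𝓘(ℝ) ∞ (fun x => η x (fun a => coordFrame I c x (J a))) (chartAt H c).source

/-- The vectors `X₁, …, Xₙ` form a basis of `T_x M` that defines the orientation `o`. -/
def IsPositiveFrame {x : M} (o : Orientation ℝ (TangentSpace I x) (Fin n))
    (X : Fin n → TangentSpace I x) : Prop :=
  ∃ b : Basis (Fin n) ℝ (TangentSpace I x), (∀ j, b j = X j) ∧ b.orientation = o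

variable (I M) in
/-- An orientation of the manifold `M`: orientations of all the tangent spaces, locally constant in
the charts. -/
structure ManifoldOrientation where
  /-- The orientation of the tangent space at `x`. -/
  at' : ∀ x : M, Orientation ℝ (TangentSpace I x) (Fin n)
  locally_constant : ∀ c : M, ∀ x ∈ (chartAt H c).source, ∀ᶠ y in 𝓝 x,
    (IsPositiveFrame (at' y) (coordFrame I c y) ↔ IsPositiveFrame (at' x) (coordFrame I c x))

open Classical in
/-- `1` if the chart around `c` preserves the orientation at `x`, and `-1` otherwise. -/
noncomputable def chartSign (o : ManifoldOrientation I M) (c x : M) : ℝ :=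
  if IsPositiveFrame (o.at' x) (coordFrame I c x) then 1 else -1

/-- The wedge product of differential forms, as a form of degree `p = k + l`. -/
noncomputable def wedge {k l p : ℕ} (h : k + l = p) (α : DForm I M k) (β : DForm I M l) :
    DForm I M p :=
  fun x => altWedge h (α x) (β x)

/-- The interior product `ι_v η`. -/
noncomputable def interiorProduct {k : ℕ} (v : ∀ x : M, TangentSpace I x)
    (η : DForm I M (k + 1)) : DForm I M k :=
  fun x => (η x).curryLeft (v x)

/-- The product of a function and a form. -/
noncomputable def fmul {k : ℕ} (f : M → ℝ) (η : DForm I M k) : DForm I M k :=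
  fun x => f x • η x

section Integral

variable [T2Space M] [CompactSpace M]

variable (I M) in
/-- A smooth partition of unity subordinate to the cover of `M` by the domains of the charts. -/
noncomputable def chartPartition : SmoothPartitionOfUnity M I M Set.univ :=
  (SmoothPartitionOfUnity.exists_isSubordinate_chartAt_source I M).choose

/-- The integral over the compact oriented manifold `M` of a form of top degree, by a partition of
unity `(ρ_c)` subordinate to the charts `φ_c`:
`∫_M η = ∑_c ∫_{im φ_c} ± (ρ_c η (∂₁, …, ∂ₙ)) ∘ φ_c⁻¹ dy`, where `∂₁, …, ∂ₙ` is the coordinate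
frame of `φ_c` and the sign is that of the chart. All but finitely many `ρ_c` vanish. -/
noncomputable def integralForm (o : ManifoldOrientation I M) (η : DForm I M n) : ℝ :=
  ∑ᶠ c : M, ∫ y in (extChartAt I c).target,
    chartSign o c ((extChartAt I c).symm y) * chartPartition I M c ((extChartAt I c).symm y) *
      η ((extChartAt I c).symm y) (coordFrame I c ((extChartAt I c).symm y))

/-- `e` is the variational derivative at `a`, with respect to the pairing `∫_M δ ∧ e` of `k`-forms
and `l`-forms (`k + l = n`), of the functional `F` of `k`-forms: `e` is a smooth `l`-form and
`d/dε F (a + ε δ) = ∫_M δ ∧ e` at `ε = 0` for every smooth `k`-form `δ`. -/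
def IsVariationalDerivative (o : ManifoldOrientation I M) {k l : ℕ} (h : k + l = n)
    (F : DForm I M k → ℝ) (a : DForm I M k) (e : DForm I M l) : Prop :=
  IsSmoothForm e ∧ ∀ δ : DForm I M k, IsSmoothForm δ →
    HasDerivAt (fun ε : ℝ => F (a + ε • δ)) (integralForm o (wedge h δ e)) 0

end Integral

section Riemannian

variable [RiemannianBundle (fun x : M => TangentSpace I x)]

/-- The Hodge star on differential forms of a Riemannian manifold of dimension `n = k + l`. -/
noncomputable def hodge (o : ManifoldOrientation I M) {k l : ℕ} (h : k + l = n)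
    (α : DForm I M k) : DForm I M l :=
  fun x => altHodge (o.at' x) h (α x)

/-- The function `*μ`, for a form `μ` of top degree. -/
noncomputable def density (o : ManifoldOrientation I M) (μ : DForm I M n) : M → ℝ :=
  fun x => hodge o (Nat.add_zero n) μ x Fin.elim0

/-- The vector field `v` with `ṽ = ⟨v, ·⟩`, for a 1-form `ṽ`. -/
noncomputable def sharp (w : DForm I M 1) : ∀ x : M, TangentSpace I x :=
  fun x => (InnerProductSpace.toDual ℝ (TangentSpace I x)).symm
    (LinearMap.toContinuousLinearMap
      ((AlternatingMap.ofSubsingleton ℝ (TangentSpace I x) ℝ (0 : Fin 1)).symm (w x)))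

end Riemannian

end Manifold

/-! ### Kinetic energy -/

section KineticEnergy

variable {m : ℕ} {H : Type*} [TopologicalSpace H]
  {I : ModelWithCorners ℝ (EuclideanSpace ℝ (Fin (m + 1))) H}
  {M : Type*} [TopologicalSpace M] [ChartedSpace H M] [IsManifold I ∞ M]
  [RiemannianBundle (fun x : M => TangentSpace I x)]

/-- Smooth pairs of a 1-form and a top form `μ` for which the function `*μ` has no zero. -/
def kineticStates (o : ManifoldOrientation I M) : Set (DForm I M 1 × DForm I M (m + 1)) :=
  {s | IsSmoothForm s.1 ∧ IsSmoothForm s.2 ∧ ∀ x, density o s.2 x ≠ 0}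

/-- The change of variables `(α, μ) ↦ (α / *μ, μ)` from momentum to velocity. -/
noncomputable def velocityMap (o : ManifoldOrientation I M)
    (s : DForm I M 1 × DForm I M (m + 1)) : DForm I M 1 × DForm I M (m + 1) :=
  (fmul (fun x => 1 / density o s.2 x) s.1, s.2)

variable [T2Space M] [CompactSpace M]

/-- The kinetic energy `∫_M (1 / (2 *μ)) α ∧ *α` in terms of the momentum `α` and the mass
form `μ`. -/
noncomputable def kineticEnergyMomentum (o : ManifoldOrientation I M) (α : DForm I M 1)
    (μ : DForm I M (m + 1)) : ℝ :=
  integralForm o (fmul (fun x => 1 / (2 * density o μ x))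
    (wedge (Nat.add_comm 1 m) α (hodge o (Nat.add_comm 1 m) α)))

/-- The functional `∫_M (1/2) (*μ) w ∧ *w` of the velocity 1-form `w` and the mass form `μ`. -/
noncomputable def kineticEnergyVelocity (o : ManifoldOrientation I M) (w : DForm I M 1)
    (μ : DForm I M (m + 1)) : ℝ :=
  integralForm o (fmul (fun x => 1 / 2 * density o μ x)
    (wedge (Nat.add_comm 1 m) w (hodge o (Nat.add_comm 1 m) w)))

end KineticEnergy

/-!
Since `β ∧ *α = ⟨β, α⟩ vol` and `(*μ) vol = μ`, the integrand `½ (*μ) w ∧ *w` of the kinetic energy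
is `½ ⟨w, w⟩ μ`: a quadratic form in `w`, whose derivative comes from polarisation, and linear in
`μ`. Variational derivatives are unique because the difference `γ` of two of them is paired to zero
with `*γ`, so that `∫ |γ|² vol = 0`, where `|γ|²` is continuous and nonnegative. That `*γ` is an
admissible test form rests on the expression of `*` in an arbitrary frame through the inverse of the
Gram matrix of the frame, which depends smoothly on the point for the coordinate frame of a chart.
-/

section AlternatingForms

variable {V : Type*} [AddCommGroup V] [Module ℝ V] {k l p : ℕ}

/-- The identification of the slots of a form of degree `p = k + l` with a block of `k` slots
followed by a block of `l` slots. -/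
def blockEquiv (h : k + l = p) : Fin k ⊕ Fin l ≃ Fin p :=
  finSumFinEquiv.trans (finCongr h)

theorem altInsert_apply (h : k + l = p) (η : V [⋀^Fin p]→ₗ[ℝ] ℝ) (u : Fin k → V) (w : Fin l → V) :
    altInsert h η u w = η (Sum.elim u w ∘ (blockEquiv h).symm) := by
  change η _ = η _
  congr 1
  ext i
  obtain ⟨s, rfl⟩ := (blockEquiv h).surjective i
  rcases s with a | b <;> simp [blockEquiv]

theorem altWedge_apply_comp_symm (h : k + l = p) (α : V [⋀^Fin k]→ₗ[ℝ] ℝ)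
    (β : V [⋀^Fin l]→ₗ[ℝ] ℝ) (X : Fin k ⊕ Fin l → V) :
    altWedge h α β (X ∘ (blockEquiv h).symm) = LinearMap.mul' ℝ ℝ (α.domCoprod β X) := by
  change LinearMap.mul' ℝ ℝ (α.domCoprod β ((X ∘ (blockEquiv h).symm) ∘ blockEquiv h)) = _
  rw [Function.comp_assoc, Equiv.symm_comp_self, Function.comp_id]

theorem altWedge_apply (h : k + l = p) (α : V [⋀^Fin k]→ₗ[ℝ] ℝ) (β : V [⋀^Fin l]→ₗ[ℝ] ℝ)
    (X : Fin p → V) :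
    altWedge h α β X = ((k.factorial * l.factorial : ℕ) : ℝ)⁻¹ *
      ∑ σ : Equiv.Perm (Fin k ⊕ Fin l), ((Equiv.Perm.sign σ : ℤ) : ℝ) *
        (α (fun a => X (blockEquiv h (σ (Sum.inl a)))) *
          β (fun b => X (blockEquiv h (σ (Sum.inr b))))) := by
  have hcoprod := congrArg (fun f => LinearMap.mul' ℝ ℝ (f (X ∘ blockEquiv h)))
    (MultilinearMap.domCoprod_alternization_eq α β)
  simp only [MultilinearMap.alternatization_apply, map_sum, Fintype.card_fin,
    AlternatingMap.smul_apply, Units.smul_def, map_nsmul, map_zsmul] at hcoprod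
  simp only [nsmul_eq_mul, zsmul_eq_mul] at hcoprod
  rw [eq_inv_mul_iff_mul_eq₀ (by positivity)]
  exact hcoprod.symm

theorem altWedge_add_left (h : k + l = p) (α α' : V [⋀^Fin k]→ₗ[ℝ] ℝ) (β : V [⋀^Fin l]→ₗ[ℝ] ℝ) :
    altWedge h (α + α') β = altWedge h α β + altWedge h α' β := by
  ext X
  simp only [altWedge_apply, AlternatingMap.add_apply, add_mul, mul_add, Finset.sum_add_distrib]

theorem altWedge_add_right (h : k + l = p) (α : V [⋀^Fin k]→ₗ[ℝ] ℝ) (β β' : V [⋀^Fin l]→ₗ[ℝ] ℝ) :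
    altWedge h α (β + β') = altWedge h α β + altWedge h α β' := by
  ext X
  simp only [altWedge_apply, AlternatingMap.add_apply, mul_add, Finset.sum_add_distrib]

theorem altWedge_smul_left (h : k + l = p) (c : ℝ) (α : V [⋀^Fin k]→ₗ[ℝ] ℝ)
    (β : V [⋀^Fin l]→ₗ[ℝ] ℝ) : altWedge h (c • α) β = c • altWedge h α β := by
  ext X
  simp only [altWedge_apply, AlternatingMap.smul_apply, smul_eq_mul, mul_assoc, mul_left_comm _ c,
    ← Finset.mul_sum]

theorem altWedge_smul_right (h : k + l = p) (c : ℝ) (α : V [⋀^Fin k]→ₗ[ℝ] ℝ)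
    (β : V [⋀^Fin l]→ₗ[ℝ] ℝ) : altWedge h α (c • β) = c • altWedge h α β := by
  ext X
  simp only [altWedge_apply, AlternatingMap.smul_apply, smul_eq_mul, mul_left_comm _ c,
    ← Finset.mul_sum]

/-- The wedge product as a bilinear map, for its commutation with finite sums. -/
noncomputable def altWedgeBilin (h : k + l = p) :
    (V [⋀^Fin k]→ₗ[ℝ] ℝ) →ₗ[ℝ] (V [⋀^Fin l]→ₗ[ℝ] ℝ) →ₗ[ℝ] (V [⋀^Fin p]→ₗ[ℝ] ℝ) :=
  LinearMap.mk₂ ℝ (altWedge h) (altWedge_add_left h) (altWedge_smul_left h) (altWedge_add_right h)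
    (altWedge_smul_right h)

theorem exists_altWedge_comm (h : k + l = p) (h' : l + k = p) :
    ∃ s : ℤˣ, ∀ (α : V [⋀^Fin k]→ₗ[ℝ] ℝ) (β : V [⋀^Fin l]→ₗ[ℝ] ℝ),
      altWedge h' β α = s • altWedge h α β := by
  let ρ : Equiv.Perm (Fin p) :=
    (blockEquiv h).symm.trans ((Equiv.sumComm _ _).trans (blockEquiv h'))
  have hρ : ∀ x, ρ (blockEquiv h x) = blockEquiv h' x.swap := fun x => by simp [ρ]
  refine ⟨Equiv.Perm.sign ρ, fun α β => ?_⟩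
  ext X
  have hperm : altWedge h' β α X = altWedge h α β (X ∘ ρ) := by
    rw [altWedge_apply, altWedge_apply, mul_comm l.factorial,
      ← Equiv.sum_comp (Equiv.sumComm (Fin k) (Fin l)).permCongr]
    congr 1
    refine Finset.sum_congr rfl fun σ _ => ?_
    rw [Equiv.Perm.sign_permCongr, mul_comm (α _)]
    simp [hρ, Equiv.permCongr_apply]
  rw [hperm, AlternatingMap.map_perm, AlternatingMap.smul_apply]

/-- The hypothesis says that only the shuffle that preserves the two blocks contributes. -/
theorem altWedge_apply_eq_mul (h : k + l = p) (α : V [⋀^Fin k]→ₗ[ℝ] ℝ) (β : V [⋀^Fin l]→ₗ[ℝ] ℝ)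
    (X : Fin k ⊕ Fin l → V)
    (hX : ∀ σ : Equiv.Perm (Fin k ⊕ Fin l),
      ¬ Set.MapsTo σ (Set.range Sum.inl) (Set.range Sum.inl) →
        α (X ∘ σ ∘ Sum.inl) * β (X ∘ σ ∘ Sum.inr) = 0) :
    altWedge h α β (X ∘ (blockEquiv h).symm) = α (X ∘ Sum.inl) * β (X ∘ Sum.inr) := by
  rw [altWedge_apply_comp_symm, AlternatingMap.domCoprod_apply, _root_.sum_apply, map_sum]
  refine (Finset.sum_eq_single (Quotient.mk'' 1 : Equiv.Perm.ModSumCongr (Fin k) (Fin l))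
    ?_ (by simp)).trans ?_
  · intro q _ hq
    induction q using Quotient.inductionOn' with | _ σ
    have hσ : ¬ Set.MapsTo σ (Set.range Sum.inl) (Set.range Sum.inl) := by
      refine fun hmaps => hq (Quotient.sound' ?_)
      rw [QuotientGroup.leftRel_apply, mul_one, inv_mem_iff]
      exact Equiv.Perm.mem_sumCongrHom_range_of_perm_mapsTo_inl hmaps
    have hzero := hX σ hσ
    simp only [Function.comp_def] at hzero
    simp [AlternatingMap.domCoprod.summand_mk'', hzero]
  · simp [AlternatingMap.domCoprod.summand_mk'', Function.comp_def]

theorem altWedge_zero_form (α : V [⋀^Fin p]→ₗ[ℝ] ℝ) (f : V [⋀^Fin 0]→ₗ[ℝ] ℝ) :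
    altWedge (Nat.add_zero p) α f = f Fin.elim0 • α := by
  ext Y
  have hblock : ∀ σ : Equiv.Perm (Fin p ⊕ Fin 0),
      Set.MapsTo σ (Set.range Sum.inl) (Set.range Sum.inl) := by
    rintro σ x -
    rcases σ x with a | b
    exacts [⟨a, rfl⟩, b.elim0]
  have hval := altWedge_apply_eq_mul (Nat.add_zero p) α f (Y ∘ blockEquiv (Nat.add_zero p))
    fun σ hσ => absurd (hblock σ) hσ
  rw [Function.comp_assoc, Equiv.self_comp_symm, Function.comp_id] at hval
  rw [hval, AlternatingMap.smul_apply, smul_eq_mul, mul_comm]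
  congr 2
  exact Subsingleton.elim _ _

theorem altInsert_one {m : ℕ} (η : V [⋀^Fin (m + 1)]→ₗ[ℝ] ℝ) (u : Fin 1 → V) :
    altInsert (Nat.add_comm 1 m) η u = η.curryLeft (u 0) := by
  ext X
  change η _ = η (Matrix.vecCons _ X)
  congr 1
  ext i
  refine Fin.cases (Fin.append_left u X (0 : Fin 1)) (fun i => ?_) i
  have hi : finCongr (Nat.add_comm 1 m).symm i.succ = Fin.natAdd 1 i :=
    Fin.ext (Nat.add_comm _ _)
  rw [Function.comp_apply, hi, Fin.append_right, Matrix.cons_val_succ]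

theorem altInsert_eq_zero_of_not_linearIndependent (h : k + l = p) (η : V [⋀^Fin p]→ₗ[ℝ] ℝ)
    {u : Fin k → V} (hu : ¬ LinearIndependent ℝ u) : altInsert h η u = 0 := by
  ext w
  rw [altInsert_apply]
  refine η.map_linearDependent _ fun hli => hu ?_
  simpa [Function.comp_def] using
    hli.comp _ ((blockEquiv h).injective.comp (Sum.inl_injective (β := Fin l)))

theorem exists_basis_comp_inl_eq [FiniteDimensional ℝ V] (hV : finrank ℝ V = k + l)
    {u : Fin k → V} (hu : LinearIndependent ℝ u) :
    ∃ c : Basis (Fin k ⊕ Fin l) ℝ V, c ∘ Sum.inl = u := by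
  let b := Basis.sumExtend hu
  have : Finite (Fin k ⊕ Basis.sumExtendIndex hu) := Module.Finite.finite_basis b
  have : Finite (Basis.sumExtendIndex hu) := Finite.sum_right (Fin k)
  have hcard : Nat.card (Basis.sumExtendIndex hu) = l := by
    have := finrank_eq_nat_card_basis b
    rw [Nat.card_sum, Nat.card_fin, hV] at this
    omega
  refine ⟨b.reindex (Equiv.sumCongr (Equiv.refl _) (Finite.equivFinOfCardEq hcard)), ?_⟩
  ext a
  simp only [b, Basis.sumExtend, Function.comp_apply, Basis.reindex_apply, Basis.extend_apply_self]
  rfl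

theorem eq_of_apply_basis_eq {ι : Type*} [Finite ι] (c : Basis ι ℝ V)
    {η θ : V [⋀^ι]→ₗ[ℝ] ℝ} (h : η c = θ c) : η = θ := by
  classical
  have := Fintype.ofFinite ι
  rw [η.eq_smul_basis_det c, θ.eq_smul_basis_det c, h]

theorem altWedge_altInsert [FiniteDimensional ℝ V] (hV : finrank ℝ V = p) (h : k + l = p)
    (β : V [⋀^Fin k]→ₗ[ℝ] ℝ) (η : V [⋀^Fin p]→ₗ[ℝ] ℝ) (u : Fin k → V) :
    altWedge h β (altInsert h η u) = β u • η := by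
  by_cases hu : LinearIndependent ℝ u
  swap
  · rw [altInsert_eq_zero_of_not_linearIndependent h η hu, β.map_linearDependent u hu, zero_smul]
    exact map_zero (altWedgeBilin h β)
  obtain ⟨c, rfl⟩ := exists_basis_comp_inl_eq (hV.trans h.symm) hu
  refine eq_of_apply_basis_eq (c.reindex (blockEquiv h)) ?_
  rw [Basis.coe_reindex, altWedge_apply_eq_mul, altInsert_apply, Sum.elim_comp_inl_inr,
    AlternatingMap.smul_apply, smul_eq_mul]
  intro σ hσ
  rw [Equiv.Perm.perm_mapsTo_inl_iff_mapsTo_inr] at hσ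
  obtain ⟨j, a, ha⟩ : ∃ (j : Fin l) (a : Fin k), σ (Sum.inr j) = Sum.inl a := by
    by_contra! hc
    refine hσ ?_
    rintro _ ⟨j, rfl⟩
    rcases hj : σ (Sum.inr j) with a | b
    exacts [absurd hj (hc j a), ⟨b, rfl⟩]
  rw [altInsert_apply, η.map_eq_zero_of_eq _ (i := blockEquiv h (Sum.inl a))
    (j := blockEquiv h (Sum.inr j)) (by simp [ha]) (by simp), mul_zero]

theorem sum_apply_basis_sq (b : Basis (Fin p) ℝ V) (η : V [⋀^Fin p]→ₗ[ℝ] ℝ) :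
    ∑ J : Fin p → Fin p, η (b ∘ J) * η (b ∘ J) = p.factorial * η b ^ 2 := by
  calc ∑ J : Fin p → Fin p, η (b ∘ J) * η (b ∘ J)
      = ∑ σ : Equiv.Perm (Fin p), η (b ∘ σ) * η (b ∘ σ) := by
        refine (Fintype.sum_of_injective (fun σ : Equiv.Perm (Fin p) => ⇑σ) DFunLike.coe_injective
          _ _ (fun J hJ => ?_) fun σ => rfl).symm
        have hJ' : ¬ Function.Injective J := fun hinj =>
          hJ ⟨Equiv.ofBijective J (Finite.injective_iff_bijective.mp hinj), rfl⟩
        rw [η.map_eq_zero_of_not_injective _ fun hinj => hJ' hinj.of_comp, mul_zero]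
    _ = ∑ σ : Equiv.Perm (Fin p), η b ^ 2 := by
        refine Finset.sum_congr rfl fun σ _ => ?_
        rw [η.map_perm, smul_mul_smul_comm, Int.units_mul_self, one_smul, sq]
    _ = p.factorial * η b ^ 2 := by simp [Fintype.card_perm]

end AlternatingForms

section GramMatrix

variable {V : Type*} [NormedAddCommGroup V] [InnerProductSpace ℝ V] {ι κ : Type*} [Fintype κ]
  {k : ℕ}

theorem toMatrix_mul_transpose_eq_gram_inv [Fintype ι] [DecidableEq κ]
    (e : OrthonormalBasis ι ℝ V) (b : Basis κ ℝ V) :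
    b.toMatrix e * (b.toMatrix e).transpose = (Matrix.gram ℝ b)⁻¹ := by
  classical
  refine (Matrix.inv_eq_left_inv ?_).symm
  have hgram : Matrix.gram ℝ b = (e.toBasis.toMatrix b).transpose * e.toBasis.toMatrix b :=
    Matrix.gram_eq_conjTranspose_mul e b
  have hinv : b.toMatrix e * e.toBasis.toMatrix b = 1 :=
    e.coe_toBasis ▸ b.toMatrix_mul_toMatrix_flip e.toBasis
  have hinv' : e.toBasis.toMatrix b * b.toMatrix e = 1 :=
    e.coe_toBasis ▸ e.toBasis.toMatrix_mul_toMatrix_flip b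
  rw [hgram, Matrix.mul_assoc, ← Matrix.mul_assoc _ (e.toBasis.toMatrix b).transpose,
    ← Matrix.transpose_mul, hinv', Matrix.transpose_one, Matrix.one_mul, hinv]

theorem map_comp_eq_sum_toMatrix (f : MultilinearMap ℝ (fun _ : Fin k => V) ℝ) (v : ι → V)
    (b : Basis κ ℝ V) (I : Fin k → ι) :
    f (v ∘ I) = ∑ J : Fin k → κ, (∏ a, b.toMatrix v (J a) (I a)) * f (b ∘ J) := by
  have hv : v ∘ I = fun a => ∑ j, b.toMatrix v j (I a) • b j := by
    ext a
    exact (b.sum_toMatrix_smul_self v (I a)).symm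
  rw [hv, MultilinearMap.map_sum]
  exact Finset.sum_congr rfl fun J _ => f.map_smul_univ _ _

theorem sum_orthonormalBasis_mul_eq_sum_gram_inv [Fintype ι] [DecidableEq κ]
    (e : OrthonormalBasis ι ℝ V) (b : Basis κ ℝ V) (f g : MultilinearMap ℝ (fun _ : Fin k => V) ℝ) :
    ∑ I : Fin k → ι, f (e ∘ I) * g (e ∘ I) =
      ∑ J : Fin k → κ, ∑ L : Fin k → κ,
        (∏ a, (Matrix.gram ℝ b)⁻¹ (J a) (L a)) * (f (b ∘ J) * g (b ∘ L)) := by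
  classical
  have hgram : ∀ J L : Fin k → κ, ∏ a, (Matrix.gram ℝ b)⁻¹ (J a) (L a) =
      ∑ I : Fin k → ι, (∏ a, b.toMatrix e (J a) (I a)) * ∏ a, b.toMatrix e (L a) (I a) := by
    intro J L
    simp only [← toMatrix_mul_transpose_eq_gram_inv e b, Matrix.mul_apply, Matrix.transpose_apply,
      Finset.prod_univ_sum, Fintype.piFinset_univ, Finset.prod_mul_distrib]
  calc ∑ I : Fin k → ι, f (e ∘ I) * g (e ∘ I)
      = ∑ I : Fin k → ι, ∑ J : Fin k → κ, ∑ L : Fin k → κ,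
          (∏ a, b.toMatrix e (J a) (I a)) * (∏ a, b.toMatrix e (L a) (I a)) *
            (f (b ∘ J) * g (b ∘ L)) := by
        simp only [map_comp_eq_sum_toMatrix f e b, map_comp_eq_sum_toMatrix g e b,
          Finset.sum_mul_sum, mul_mul_mul_comm]
    _ = _ := by
        simp only [hgram, Finset.sum_mul]
        rw [Finset.sum_comm]
        exact Finset.sum_congr rfl fun J _ => Finset.sum_comm

theorem sum_orthonormalBasis_mul_eq [Fintype ι] (e : OrthonormalBasis ι ℝ V)
    (b : OrthonormalBasis κ ℝ V) (f g : MultilinearMap ℝ (fun _ : Fin k => V) ℝ) :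
    ∑ I : Fin k → ι, f (e ∘ I) * g (e ∘ I) = ∑ J : Fin k → κ, f (b ∘ J) * g (b ∘ J) := by
  classical
  exact (sum_orthonormalBasis_mul_eq_sum_gram_inv e b.toBasis f g).trans
    (sum_orthonormalBasis_mul_eq_sum_gram_inv b b.toBasis f g).symm

end GramMatrix

section InnerProduct

variable {V : Type*} [NormedAddCommGroup V] [InnerProductSpace ℝ V] [FiniteDimensional ℝ V] {k : ℕ}

/-- The inner product of alternating `k`-forms for which the forms `e^{i₁} ∧ … ∧ e^{i_k}`,
`i₁ < … < i_k`, of an orthonormal basis are orthonormal; since the sum runs over all `k`-tuples, it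
is divided by `k!`. -/
noncomputable def altInner (α β : V [⋀^Fin k]→ₗ[ℝ] ℝ) : ℝ :=
  (k.factorial : ℝ)⁻¹ * ∑ J : Fin k → Fin (finrank ℝ V),
    α (stdOrthonormalBasis ℝ V ∘ J) * β (stdOrthonormalBasis ℝ V ∘ J)

theorem altInner_comm (α β : V [⋀^Fin k]→ₗ[ℝ] ℝ) : altInner α β = altInner β α := by
  simp only [altInner, mul_comm (α _)]

theorem altInner_self_nonneg (α : V [⋀^Fin k]→ₗ[ℝ] ℝ) : 0 ≤ altInner α α :=
  mul_nonneg (by positivity) (Finset.sum_nonneg fun _ _ => mul_self_nonneg _)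

theorem altInner_self_eq_zero {α : V [⋀^Fin k]→ₗ[ℝ] ℝ} : altInner α α = 0 ↔ α = 0 := by
  refine ⟨fun h => ?_, fun h => by simp [h, altInner]⟩
  rw [altInner, mul_eq_zero_iff_left (by positivity),
    Finset.sum_eq_zero_iff_of_nonneg fun _ _ => mul_self_nonneg _] at h
  exact Basis.ext_alternating (stdOrthonormalBasis ℝ V).toBasis fun J _ => by
    simpa [Function.comp_def] using h J (Finset.mem_univ J)

theorem altInner_add_smul_self (α δ : V [⋀^Fin k]→ₗ[ℝ] ℝ) (ε : ℝ) :
    altInner (α + ε • δ) (α + ε • δ) =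
      altInner α α + 2 * ε * altInner δ α + ε ^ 2 * altInner δ δ := by
  simp only [altInner, Finset.mul_sum, ← Finset.sum_add_distrib]
  refine Finset.sum_congr rfl fun J _ => ?_
  simp only [AlternatingMap.add_apply, AlternatingMap.smul_apply, smul_eq_mul]
  ring

theorem altInner_eq_sum_gram_inv {κ : Type*} [Fintype κ] [DecidableEq κ] (b : Basis κ ℝ V)
    (α β : V [⋀^Fin k]→ₗ[ℝ] ℝ) :
    altInner α β = (k.factorial : ℝ)⁻¹ * ∑ J : Fin k → κ, ∑ L : Fin k → κ,
      (∏ a, (Matrix.gram ℝ b)⁻¹ (J a) (L a)) * (α (b ∘ J) * β (b ∘ L)) :=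
  congrArg _ (sum_orthonormalBasis_mul_eq_sum_gram_inv (stdOrthonormalBasis ℝ V) b
    α.toMultilinearMap β.toMultilinearMap)

end InnerProduct

section VolumeForm

variable {V : Type*} [NormedAddCommGroup V] [InnerProductSpace ℝ V] [FiniteDimensional ℝ V] {n : ℕ}
  [Fact (finrank ℝ V = n)] (o : Orientation ℝ V (Fin n))

theorem nonempty_orthonormalBasis_fin : Nonempty (OrthonormalBasis (Fin n) ℝ V) :=
  ⟨(stdOrthonormalBasis ℝ V).reindex (finCongr Fact.out)⟩

theorem volumeForm_sq_eq_det_gram (X : Fin n → V) :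
    o.volumeForm X ^ 2 = (Matrix.gram ℝ X).det := by
  obtain ⟨e⟩ := nonempty_orthonormalBasis_fin (V := V) (n := n)
  have hgram : Matrix.gram ℝ X = (e.toBasis.toMatrix X).transpose * e.toBasis.toMatrix X :=
    Matrix.gram_eq_conjTranspose_mul e X
  rw [← sq_abs, o.volumeForm_robust' e, sq_abs, hgram, Matrix.det_mul, Matrix.det_transpose,
    Basis.det_apply, sq]

theorem volumeForm_basis_ne_zero (b : Basis (Fin n) ℝ V) : o.volumeForm b ≠ 0 := by
  rw [← sq_pos_iff, volumeForm_sq_eq_det_gram]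
  exact (Matrix.posDef_gram_of_linearIndependent b.linearIndependent).det_pos

theorem volumeForm_ne_zero : o.volumeForm ≠ 0 := by
  obtain ⟨e⟩ := nonempty_orthonormalBasis_fin (V := V) (n := n)
  exact fun h => volumeForm_basis_ne_zero o e.toBasis (by rw [h, AlternatingMap.zero_apply])

theorem volumeForm_pos_iff (b : Basis (Fin n) ℝ V) :
    0 < o.volumeForm b ↔ b.orientation = o := by
  obtain ⟨e⟩ := nonempty_orthonormalBasis_fin (V := V) (n := n)
  have hdet : e.toBasis.det b ≠ 0 := (e.toBasis.isUnit_det b).ne_zero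
  by_cases ho : e.toBasis.orientation = o
  · rw [o.volumeForm_robust e ho, ← ho, ← Basis.orientation_eq_iff_det_pos, eq_comm]
  · have hneg := (e.toBasis.orientation_ne_iff_eq_neg o).mp (Ne.symm ho)
    rw [o.volumeForm_robust_neg e ho, hneg, ← Basis.orientation_ne_iff_eq_neg, ne_comm, Ne,
      Basis.orientation_eq_iff_det_pos, AlternatingMap.neg_apply, neg_pos, not_lt,
      hdet.le_iff_lt]

end VolumeForm

section Hodge

variable {V : Type*} [NormedAddCommGroup V] [InnerProductSpace ℝ V] [FiniteDimensional ℝ V] {n : ℕ}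
  [Fact (finrank ℝ V = n)] (o : Orientation ℝ V (Fin n)) {k l : ℕ} (h : k + l = n)

theorem altHodge_smul (c : ℝ) (α : V [⋀^Fin k]→ₗ[ℝ] ℝ) :
    altHodge o h (c • α) = c • altHodge o h α := by
  rw [altHodge, altHodge, smul_comm c, Finset.smul_sum (r := c)]
  simp only [AlternatingMap.smul_apply, smul_assoc]

theorem altWedge_altHodge (β α : V [⋀^Fin k]→ₗ[ℝ] ℝ) :
    altWedge h β (altHodge o h α) = altInner β α • o.volumeForm := by
  calc altWedge h β (altHodge o h α) = altWedgeBilin h β (altHodge o h α) := rfl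
    _ = (k.factorial : ℝ)⁻¹ • ∑ J : Fin k → Fin (finrank ℝ V),
          α (stdOrthonormalBasis ℝ V ∘ J) •
            altWedge h β (altInsert h o.volumeForm (stdOrthonormalBasis ℝ V ∘ J)) := by
        rw [altHodge, map_smul, map_sum]
        simp only [map_smul]
        rfl
    _ = altInner β α • o.volumeForm := by
        simp only [altWedge_altInsert Fact.out, altInner, smul_smul, ← Finset.sum_smul, mul_comm]

theorem altHodge_apply_eq_sum_gram_inv (b : Basis (Fin n) ℝ V) (α : V [⋀^Fin k]→ₗ[ℝ] ℝ)
    (w : Fin l → V) :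
    altHodge o h α w = (k.factorial : ℝ)⁻¹ * ∑ J : Fin k → Fin n, ∑ L : Fin k → Fin n,
      (∏ a, (Matrix.gram ℝ b)⁻¹ (J a) (L a)) *
        (α (b ∘ J) * altInsert h o.volumeForm (b ∘ L) w) := by
  let g : MultilinearMap ℝ (fun _ : Fin k => V) ℝ :=
    (o.volumeForm.toMultilinearMap.domDomCongr
      ((blockEquiv h).symm.trans (Equiv.sumComm _ _))).currySum w
  have hg : ∀ u, g u = altInsert h o.volumeForm u w := by
    intro u
    rw [altInsert_apply]
    change o.volumeForm _ = o.volumeForm _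
    congr 1
    ext i
    rcases hi : (blockEquiv h).symm i with a | a <;> simp [hi]
  have hsum := sum_orthonormalBasis_mul_eq_sum_gram_inv (stdOrthonormalBasis ℝ V) b
    α.toMultilinearMap g
  simp only [hg] at hsum
  refine Eq.trans ?_ (congrArg _ hsum)
  rw [altHodge, AlternatingMap.smul_apply, smul_eq_mul, ← AlternatingMap.coe_multilinearMap,
    ← AlternatingMap.toMultilinearMapLM_apply (S := ℝ), map_sum, _root_.sum_apply]
  rfl

theorem altInner_volumeForm_self : altInner o.volumeForm o.volumeForm = 1 := by
  obtain ⟨e⟩ := nonempty_orthonormalBasis_fin (V := V) (n := n)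
  have hsum := sum_orthonormalBasis_mul_eq (stdOrthonormalBasis ℝ V) e
    o.volumeForm.toMultilinearMap o.volumeForm.toMultilinearMap
  simp only [AlternatingMap.coe_multilinearMap] at hsum
  rw [altInner, hsum, ← e.coe_toBasis, sum_apply_basis_sq, e.coe_toBasis, ← sq_abs,
    o.abs_volumeForm_apply_of_orthonormal, one_pow, mul_one,
    inv_mul_cancel₀ (by positivity)]

theorem altHodge_top_smul_volumeForm (μ : V [⋀^Fin n]→ₗ[ℝ] ℝ) :
    altHodge o (Nat.add_zero n) μ Fin.elim0 • o.volumeForm = μ := by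
  have hone : altHodge o (Nat.add_zero n) o.volumeForm Fin.elim0 = 1 := by
    refine smul_left_injective ℝ (volumeForm_ne_zero o) ?_
    dsimp only
    rw [← altWedge_zero_form, altWedge_altHodge, altInner_volumeForm_self]
  rw [← altWedge_zero_form, altWedge_altHodge, altInner_comm,
    ← altWedge_altHodge o (Nat.add_zero n), altWedge_zero_form, hone, one_smul]

end Hodge

section OneForm

variable {V : Type*} [NormedAddCommGroup V] [InnerProductSpace ℝ V] [FiniteDimensional ℝ V]

/-- The vector `v` that represents a `1`-form `⟨v, ·⟩`: the value of `sharp` at a point. -/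
noncomputable def altSharp (w : V [⋀^Fin 1]→ₗ[ℝ] ℝ) : V :=
  (InnerProductSpace.toDual ℝ V).symm (LinearMap.toContinuousLinearMap
    ((AlternatingMap.ofSubsingleton ℝ V ℝ (0 : Fin 1)).symm w))

theorem inner_altSharp (w : V [⋀^Fin 1]→ₗ[ℝ] ℝ) (v : V) :
    inner ℝ (altSharp w) v = w (fun _ => v) := by
  rw [altSharp, InnerProductSpace.toDual_symm_apply]
  rfl

theorem altInner_one_form (β w : V [⋀^Fin 1]→ₗ[ℝ] ℝ) :
    altInner β w = β (fun _ => altSharp w) := by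
  let e := stdOrthonormalBasis ℝ V
  let β' := (AlternatingMap.ofSubsingleton ℝ V ℝ (0 : Fin 1)).symm β
  calc altInner β w = ∑ J : Fin 1 → Fin (finrank ℝ V), β (e ∘ J) * w (e ∘ J) := by
        rw [altInner, Nat.factorial_one, Nat.cast_one, inv_one, one_mul]
    _ = ∑ j, inner ℝ (e j) (altSharp w) * β' (e j) := by
        rw [← Equiv.sum_comp (Equiv.funUnique (Fin 1) _).symm]
        refine Finset.sum_congr rfl fun j _ => ?_
        rw [real_inner_comm, inner_altSharp, mul_comm]
        rfl
    _ = β' (∑ j, inner ℝ (e j) (altSharp w) • e j) := by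
        simp only [map_sum, map_smul, smul_eq_mul]
    _ = β (fun _ => altSharp w) := by
        rw [e.sum_repr']
        rfl

variable {m : ℕ} [Fact (finrank ℝ V = m + 1)] (o : Orientation ℝ V (Fin (m + 1)))

theorem altHodge_one_form (w : V [⋀^Fin 1]→ₗ[ℝ] ℝ) :
    altHodge o (Nat.add_comm 1 m) w = o.volumeForm.curryLeft (altSharp w) := by
  let e := stdOrthonormalBasis ℝ V
  calc altHodge o (Nat.add_comm 1 m) w
      = ∑ J : Fin 1 → Fin (finrank ℝ V),
          w (fun a => e (J a)) • o.volumeForm.curryLeft (e (J 0)) := by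
        simp only [altHodge, altInsert_one, Nat.factorial_one, Nat.cast_one, inv_one, one_smul, e]
    _ = ∑ j, inner ℝ (altSharp w) (e j) • o.volumeForm.curryLeft (e j) := by
        rw [← Equiv.sum_comp (Equiv.funUnique (Fin 1) _).symm]
        simp [inner_altSharp]
    _ = o.volumeForm.curryLeft (altSharp w) := by
        simp only [← map_smul, ← map_sum, real_inner_comm _ (altSharp w)]
        rw [e.sum_repr']

end OneForm

section Forms

variable {n : ℕ} {H : Type*} [TopologicalSpace H]
  {I : ModelWithCorners ℝ (EuclideanSpace ℝ (Fin n)) H}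
  {M : Type*} [TopologicalSpace M] [ChartedSpace H M] {k l p : ℕ}

theorem wedge_add_left (h : k + l = p) (α α' : DForm I M k) (β : DForm I M l) :
    wedge h (α + α') β = wedge h α β + wedge h α' β :=
  funext fun _ => altWedge_add_left h _ _ _

theorem wedge_add_right (h : k + l = p) (α : DForm I M k) (β β' : DForm I M l) :
    wedge h α (β + β') = wedge h α β + wedge h α β' :=
  funext fun _ => altWedge_add_right h _ _ _

theorem wedge_fmul_left (h : k + l = p) (f : M → ℝ) (α : DForm I M k) (β : DForm I M l) :
    wedge h (fmul f α) β = fmul f (wedge h α β) :=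
  funext fun _ => altWedge_smul_left h _ _ _

theorem wedge_fmul_right (h : k + l = p) (f : M → ℝ) (α : DForm I M k) (β : DForm I M l) :
    wedge h α (fmul f β) = fmul f (wedge h α β) :=
  funext fun _ => altWedge_smul_right h _ _ _

theorem wedge_smul_left (h : k + l = p) (r : ℝ) (α : DForm I M k) (β : DForm I M l) :
    wedge h (r • α) β = r • wedge h α β :=
  wedge_fmul_left h (fun _ => r) α β

theorem wedge_smul_right (h : k + l = p) (r : ℝ) (α : DForm I M k) (β : DForm I M l) :
    wedge h α (r • β) = r • wedge h α β :=
  wedge_fmul_right h (fun _ => r) α β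

theorem exists_wedge_comm (h : k + l = p) (h' : l + k = p) :
    ∃ s : ℤˣ, ∀ (α : DForm I M k) (β : DForm I M l),
      wedge h' β α = ((s : ℤ) : ℝ) • wedge h α β := by
  obtain ⟨s, hs⟩ := exists_altWedge_comm (V := EuclideanSpace ℝ (Fin n)) h h'
  refine ⟨s, fun α β => funext fun x => (hs (α x) (β x)).trans ?_⟩
  rw [Units.smul_def, ← Int.cast_smul_eq_zsmul ℝ]
  rfl

theorem fmul_fmul (f g : M → ℝ) (η : DForm I M k) : fmul f (fmul g η) = fmul (f * g) η :=
  funext fun _ => smul_smul _ _ _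

theorem interiorProduct_fmul (v : ∀ x : M, TangentSpace I x) (f : M → ℝ)
    (η : DForm I M (k + 1)) : interiorProduct v (fmul f η) = fmul f (interiorProduct v η) :=
  rfl

theorem interiorProduct_one_form_apply (v : ∀ x : M, TangentSpace I x) (w : DForm I M 1) (x : M)
    (X : Fin 0 → TangentSpace I x) : interiorProduct v w x X = w x (fun _ => v x) := by
  change w x (Fin.cons _ _ : Fin 1 → _) = _
  congr 1
  funext a
  exact Fin.cases rfl (fun b => b.elim0) a

end Forms

section SmoothMatrices

variable {E : Type*} [NormedAddCommGroup E] [NormedSpace ℝ E] {H : Type*} [TopologicalSpace H]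
  {I : ModelWithCorners ℝ E H} {M : Type*} [TopologicalSpace M] [ChartedSpace H M]
  {r : WithTop ℕ∞}

theorem contMDiffOn_det {ι : Type*} [Fintype ι] [DecidableEq ι] {A : M → Matrix ι ι ℝ} {s : Set M}
    (hA : ∀ i j, ContMDiffOn I 𝓘(ℝ) r (fun x => A x i j) s) :
    ContMDiffOn I 𝓘(ℝ) r (fun x => (A x).det) s := by
  simp only [Matrix.det_apply']
  exact contMDiffOn_finsetSum fun σ _ =>
    contMDiffOn_const.mul (contMDiffOn_finsetProd fun i _ => hA _ _)

theorem contMDiffOn_matrix_inv {ι : Type*} [Fintype ι] [DecidableEq ι] {A : M → Matrix ι ι ℝ}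
    {s : Set M} (hA : ∀ i j, ContMDiffOn I 𝓘(ℝ) r (fun x => A x i j) s)
    (hdet : ∀ x ∈ s, (A x).det ≠ 0) (i j : ι) :
    ContMDiffOn I 𝓘(ℝ) r (fun x => (A x)⁻¹ i j) s := by
  have hcramer : ∀ x, (A x)⁻¹ i j = (A x).det⁻¹ * ((A x).updateRow j (Pi.single i 1)).det := by
    intro x
    rw [Matrix.inv_def, Ring.inverse_eq_inv', Matrix.smul_apply, Matrix.adjugate_apply, smul_eq_mul]
  simp only [hcramer]
  refine ((contMDiffOn_det hA).inv₀ hdet).mul (contMDiffOn_det fun k l => ?_)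
  by_cases hk : k = j
  · subst hk
    simp only [Matrix.updateRow_self]
    exact contMDiffOn_const
  · simp only [Matrix.updateRow_ne hk]
    exact hA k l

theorem contMDiff_of_contMDiffOn_chart_source {f : M → ℝ}
    (hf : ∀ c : M, ContMDiffOn I 𝓘(ℝ) r f (chartAt H c).source) : ContMDiff I 𝓘(ℝ) r f :=
  fun x => (hf x).contMDiffAt ((chartAt H x).open_source.mem_nhds (mem_chart_source H x))

end SmoothMatrices

section SmoothForms

variable {n : ℕ} {H : Type*} [TopologicalSpace H]
  {I : ModelWithCorners ℝ (EuclideanSpace ℝ (Fin n)) H}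
  {M : Type*} [TopologicalSpace M] [ChartedSpace H M] [IsManifold I ∞ M]

variable (I) in
theorem exists_basis_eq_coordFrame {c x : M} (hx : x ∈ (chartAt H c).source) :
    ∃ b : Basis (Fin n) ℝ (TangentSpace I x), ⇑b = coordFrame I c x := by
  let e := trivializationAt (EuclideanSpace ℝ (Fin n)) (TangentSpace I : M → Type _) c
  have hx' : x ∈ e.baseSet := hx
  refine ⟨(EuclideanSpace.basisFun (Fin n) ℝ).toBasis.map
    (e.continuousLinearEquivAt ℝ x hx').symm.toLinearEquiv, ?_⟩
  funext j
  rw [Basis.map_apply, OrthonormalBasis.coe_toBasis]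
  exact congrFun (e.symm_continuousLinearEquivAt_eq hx') _

variable {k l p : ℕ}

theorem IsSmoothForm.add {η θ : DForm I M k} (hη : IsSmoothForm η) (hθ : IsSmoothForm θ) :
    IsSmoothForm (η + θ) :=
  fun c J => (hη c J).add (hθ c J)

theorem IsSmoothForm.sub {η θ : DForm I M k} (hη : IsSmoothForm η) (hθ : IsSmoothForm θ) :
    IsSmoothForm (η - θ) :=
  fun c J => (hη c J).sub (hθ c J)

theorem IsSmoothForm.fmul {f : M → ℝ} {η : DForm I M k} (hf : ContMDiff I 𝓘(ℝ) ∞ f)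
    (hη : IsSmoothForm η) : IsSmoothForm (fmul f η) :=
  fun c J => hf.contMDiffOn.mul (hη c J)

theorem IsSmoothForm.const_smul {η : DForm I M k} (hη : IsSmoothForm η) (r : ℝ) :
    IsSmoothForm (r • η) :=
  hη.fmul (contMDiff_const (c := r))

theorem IsSmoothForm.wedge (h : k + l = p) {η : DForm I M k} {θ : DForm I M l}
    (hη : IsSmoothForm η) (hθ : IsSmoothForm θ) : IsSmoothForm (wedge h η θ) := by
  intro c J
  simp only [_root_.wedge, altWedge_apply]
  exact contMDiffOn_const.mul (contMDiffOn_finsetSum fun σ _ => contMDiffOn_const.mul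
    ((hη c _).mul (hθ c _)))

theorem isSmoothForm_of_top {η : DForm I M n}
    (h : ∀ c : M, ContMDiffOn I 𝓘(ℝ) ∞ (fun x => η x (coordFrame I c x)) (chartAt H c).source) :
    IsSmoothForm η := by
  intro c J
  by_cases hJ : Function.Injective J
  · let τ : Equiv.Perm (Fin n) := Equiv.ofBijective J (Finite.injective_iff_bijective.mp hJ)
    have hτ : ∀ x, η x (fun a => coordFrame I c x (J a)) =
        ((Equiv.Perm.sign τ : ℤ) : ℝ) * η x (coordFrame I c x) := fun x => by
      rw [← zsmul_eq_mul, ← Units.smul_def, ← AlternatingMap.map_perm]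
      rfl
    simp only [hτ]
    exact contMDiffOn_const.mul (h c)
  · have hzero : ∀ x, η x (fun a => coordFrame I c x (J a)) = 0 := fun x =>
      (η x).map_eq_zero_of_not_injective _ fun hinj => hJ (.of_comp (f := coordFrame I c x) hinj)
    simp only [hzero]
    exact contMDiffOn_const

theorem eventually_chartSign_eq (o : ManifoldOrientation I M) {c x : M}
    (hx : x ∈ (chartAt H c).source) : ∀ᶠ y in 𝓝 x, chartSign o c y = chartSign o c x := by
  filter_upwards [o.locally_constant c x hx] with y hy
  rw [chartSign, chartSign, propext hy]

theorem contMDiffOn_chartSign (o : ManifoldOrientation I M) (c : M) :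
    ContMDiffOn I 𝓘(ℝ) ∞ (chartSign o c) (chartAt H c).source :=
  fun x hx => ((contMDiffAt_const (c := chartSign o c x)).congr_of_eventuallyEq
    (eventually_chartSign_eq o hx)).contMDiffWithinAt

theorem chartSign_mul_self (o : ManifoldOrientation I M) (c x : M) :
    chartSign o c x * chartSign o c x = 1 := by
  unfold chartSign
  split_ifs <;> norm_num

end SmoothForms

section RiemannianForms

variable {n : ℕ} {H : Type*} [TopologicalSpace H]
  {I : ModelWithCorners ℝ (EuclideanSpace ℝ (Fin n)) H}
  {M : Type*} [TopologicalSpace M] [ChartedSpace H M]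
  [RiemannianBundle (fun x : M => TangentSpace I x)] {k l : ℕ}

/-- The function `⟨α, β⟩`, for the fibrewise inner product of differential forms. -/
noncomputable def formInner (α β : DForm I M k) : M → ℝ :=
  fun x => altInner (α x) (β x)

theorem formInner_self_eq_zero {α : DForm I M k} : formInner α α = 0 ↔ α = 0 :=
  ⟨fun hα => funext fun x => altInner_self_eq_zero.mp (congrFun hα x),
    fun hα => funext fun x => altInner_self_eq_zero.mpr (congrFun hα x)⟩

variable [IsManifold I ∞ M]

/-- The Riemannian volume form. -/
noncomputable def volForm (o : ManifoldOrientation I M) : DForm I M n :=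
  fun x => (o.at' x).volumeForm

variable (o : ManifoldOrientation I M) (h : k + l = n)

theorem hodge_fmul (f : M → ℝ) (α : DForm I M k) :
    hodge o h (fmul f α) = fmul f (hodge o h α) :=
  funext fun _ => altHodge_smul _ h _ _

theorem wedge_hodge (β α : DForm I M k) :
    wedge h β (hodge o h α) = fmul (formInner β α) (volForm o) :=
  funext fun _ => altWedge_altHodge _ h _ _

theorem fmul_density_volForm (μ : DForm I M n) : fmul (density o μ) (volForm o) = μ :=
  funext fun _ => altHodge_top_smul_volumeForm _ _

theorem fmul_density_wedge_hodge (μ : DForm I M n) (β α : DForm I M k) :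
    fmul (density o μ) (wedge h β (hodge o h α)) = fmul (formInner β α) μ := by
  rw [wedge_hodge, fmul_fmul, mul_comm, ← fmul_fmul, fmul_density_volForm]

theorem chartSign_mul_volForm_pos {c x : M} (hx : x ∈ (chartAt H c).source) :
    0 < chartSign o c x * volForm o x (coordFrame I c x) := by
  obtain ⟨b, hb⟩ := exists_basis_eq_coordFrame I hx
  have hpos : IsPositiveFrame (o.at' x) (coordFrame I c x) ↔
      0 < volForm o x (coordFrame I c x) := by
    rw [← hb]
    refine Iff.trans ⟨?_, fun ho => ⟨b, fun _ => rfl, ho⟩⟩ (volumeForm_pos_iff (o.at' x) b).symm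
    rintro ⟨b', hb', ho⟩
    rwa [← Basis.eq_of_apply_eq hb']
  have hne : volForm o x (coordFrame I c x) ≠ 0 := hb ▸ volumeForm_basis_ne_zero (o.at' x) b
  unfold chartSign
  split_ifs with hframe
  · simpa using hpos.mp hframe
  · simpa using (not_lt.mp (mt hpos.mpr hframe)).lt_of_ne hne

theorem volForm_coordFrame {c x : M} (hx : x ∈ (chartAt H c).source) :
    volForm o x (coordFrame I c x) =
      chartSign o c x * √(Matrix.gram ℝ (coordFrame I c x)).det := by
  have hsqrt : √(Matrix.gram ℝ (coordFrame I c x)).det =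
      chartSign o c x * volForm o x (coordFrame I c x) := by
    rw [← volumeForm_sq_eq_det_gram (o.at' x), Real.sqrt_eq_iff_mul_self_eq_of_pos
      (chartSign_mul_volForm_pos o hx), mul_mul_mul_comm, chartSign_mul_self, one_mul, ← sq]
    rfl
  rw [hsqrt, ← mul_assoc, chartSign_mul_self, one_mul]

theorem det_gram_coordFrame_pos {c x : M} (hx : x ∈ (chartAt H c).source) :
    0 < (Matrix.gram ℝ (coordFrame I c x)).det := by
  obtain ⟨b, hb⟩ := exists_basis_eq_coordFrame I hx
  exact hb ▸ (Matrix.posDef_gram_of_linearIndependent b.linearIndependent).det_pos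

variable [IsContMDiffRiemannianBundle I ∞ (EuclideanSpace ℝ (Fin n))
  (fun x : M => TangentSpace I x)]

theorem contMDiffOn_inner_coordFrame (c : M) (i j : Fin n) :
    ContMDiffOn I 𝓘(ℝ) ∞ (fun x => (inner ℝ (coordFrame I c x i) (coordFrame I c x j) : ℝ))
      (chartAt H c).source := by
  let e := trivializationAt (EuclideanSpace ℝ (Fin n)) (TangentSpace I : M → Type _) c
  have hframe : ∀ j : Fin n, ContMDiffOn I (I.prod 𝓘(ℝ, EuclideanSpace ℝ (Fin n))) ∞
      (fun x => (TotalSpace.mk' (EuclideanSpace ℝ (Fin n)) x (coordFrame I c x j) :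
        TotalSpace (EuclideanSpace ℝ (Fin n)) (TangentSpace I : M → Type _)))
      (chartAt H c).source := by
    intro j
    refine (e.contMDiffOn_section_baseSet_iff (IB := I) (n := ∞)).mpr ?_
    refine (contMDiffOn_const (c := EuclideanSpace.basisFun (Fin n) ℝ j)).congr fun y hy => ?_
    rw [← e.continuousLinearMapAt_symmL (R := ℝ) hy (EuclideanSpace.basisFun (Fin n) ℝ j),
      ← e.coe_continuousLinearEquivAt_eq hy]
    rfl
  exact ContMDiffOn.inner_bundle (hframe i) (hframe j)

theorem contMDiffOn_gram_inv_coordFrame (c : M) (i j : Fin n) :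
    ContMDiffOn I 𝓘(ℝ) ∞ (fun x => (Matrix.gram ℝ (coordFrame I c x))⁻¹ i j)
      (chartAt H c).source :=
  contMDiffOn_matrix_inv (contMDiffOn_inner_coordFrame c)
    (fun _ hx => (det_gram_coordFrame_pos hx).ne') i j

theorem isSmoothForm_volForm : IsSmoothForm (volForm o) := by
  refine isSmoothForm_of_top fun c => ?_
  have hsqrt : ContMDiffOn I 𝓘(ℝ) ∞ (fun x => √(Matrix.gram ℝ (coordFrame I c x)).det)
      (chartAt H c).source := fun x hx =>
    (Real.contDiffAt_sqrt (det_gram_coordFrame_pos hx).ne').contMDiffAt.comp_contMDiffWithinAt x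
      (contMDiffOn_det (contMDiffOn_inner_coordFrame c) x hx)
  exact ((contMDiffOn_chartSign o c).mul hsqrt).congr fun x hx => volForm_coordFrame o hx

theorem contMDiff_formInner {α β : DForm I M k} (hα : IsSmoothForm α) (hβ : IsSmoothForm β) :
    ContMDiff I 𝓘(ℝ) ∞ (formInner α β) := by
  refine contMDiff_of_contMDiffOn_chart_source fun c => ContMDiffOn.congr
    (f := fun x => (k.factorial : ℝ)⁻¹ * ∑ J : Fin k → Fin n, ∑ L : Fin k → Fin n,
      (∏ a, (Matrix.gram ℝ (coordFrame I c x))⁻¹ (J a) (L a)) *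
        (α x (coordFrame I c x ∘ J) * β x (coordFrame I c x ∘ L))) ?_ fun x hx => ?_
  · exact contMDiffOn_const.mul (contMDiffOn_finsetSum fun J _ => contMDiffOn_finsetSum fun L _ =>
      (contMDiffOn_finsetProd fun a _ => contMDiffOn_gram_inv_coordFrame c _ _).mul
        ((hα c J).mul (hβ c L)))
  · obtain ⟨b, hb⟩ := exists_basis_eq_coordFrame I hx
    rw [← hb]
    exact altInner_eq_sum_gram_inv b (α x) (β x)

theorem IsSmoothForm.hodge {α : DForm I M k} (hα : IsSmoothForm α) :
    IsSmoothForm (hodge o h α) := by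
  intro c K
  refine ContMDiffOn.congr
    (f := fun x => (k.factorial : ℝ)⁻¹ * ∑ J : Fin k → Fin n, ∑ L : Fin k → Fin n,
      (∏ a, (Matrix.gram ℝ (coordFrame I c x))⁻¹ (J a) (L a)) *
        (α x (coordFrame I c x ∘ J) * volForm o x (coordFrame I c x ∘
          Sum.elim L K ∘ (blockEquiv h).symm))) ?_ fun x hx => ?_
  · exact contMDiffOn_const.mul (contMDiffOn_finsetSum fun J _ => contMDiffOn_finsetSum fun L _ =>
      (contMDiffOn_finsetProd fun a _ => contMDiffOn_gram_inv_coordFrame c _ _).mul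
        ((hα c J).mul (isSmoothForm_volForm o c _)))
  · obtain ⟨b, hb⟩ := exists_basis_eq_coordFrame I hx
    rw [← hb]
    refine (altHodge_apply_eq_sum_gram_inv (o.at' x) h b (α x) (b ∘ K)).trans ?_
    simp only [altInsert_apply, ← Sum.comp_elim, Function.comp_assoc]
    rfl

theorem contMDiff_density {μ : DForm I M n} (hμ : IsSmoothForm μ) :
    ContMDiff I 𝓘(ℝ) ∞ (density o μ) :=
  contMDiff_of_contMDiffOn_chart_source fun c =>
    ((hμ.hodge o (Nat.add_zero n)) c Fin.elim0).congr fun _ _ =>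
      congrArg (hodge o (Nat.add_zero n) μ _) (Subsingleton.elim _ _)

end RiemannianForms

section OneForms

variable {m : ℕ} {H : Type*} [TopologicalSpace H]
  {I : ModelWithCorners ℝ (EuclideanSpace ℝ (Fin (m + 1))) H}
  {M : Type*} [TopologicalSpace M] [ChartedSpace H M]
  [RiemannianBundle (fun x : M => TangentSpace I x)]

theorem interiorProduct_sharp_apply (β w : DForm I M 1) (x : M) (X : Fin 0 → TangentSpace I x) :
    interiorProduct (sharp w) β x X = formInner β w x :=
  (interiorProduct_one_form_apply (sharp w) β x X).trans (altInner_one_form (β x) (w x)).symm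

variable [IsManifold I ∞ M]

theorem hodge_one_form (o : ManifoldOrientation I M) (w : DForm I M 1) :
    hodge o (Nat.add_comm 1 m) w = interiorProduct (sharp w) (volForm o) :=
  funext fun _ => altHodge_one_form _ _

theorem fmul_density_hodge (o : ManifoldOrientation I M) (w : DForm I M 1)
    (μ : DForm I M (m + 1)) :
    fmul (density o μ) (hodge o (Nat.add_comm 1 m) w) = interiorProduct (sharp w) μ := by
  rw [hodge_one_form, ← interiorProduct_fmul, fmul_density_volForm]

theorem isSmoothForm_interiorProduct_sharp_one_form
    [IsContMDiffRiemannianBundle I ∞ (EuclideanSpace ℝ (Fin (m + 1)))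
      (fun x : M => TangentSpace I x)] {β w : DForm I M 1} (hβ : IsSmoothForm β)
    (hw : IsSmoothForm w) : IsSmoothForm (interiorProduct (sharp w) β) := fun _ _ => by
  simp only [interiorProduct_sharp_apply]
  exact (contMDiff_formInner hβ hw).contMDiffOn

end OneForms

section ChartTargets

variable {E : Type*} [NormedAddCommGroup E] [NormedSpace ℝ E] {H : Type*} [TopologicalSpace H]
  {I : ModelWithCorners ℝ E H} {M : Type*} [TopologicalSpace M] [ChartedSpace H M]

theorem measurableSet_extChartAt_target [MeasurableSpace E] [OpensMeasurableSpace E] (c : M) :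
    MeasurableSet (extChartAt I c).target := by
  rw [extChartAt_target]
  exact ((chartAt H c).open_target.preimage I.continuous_symm).measurableSet.inter
    I.isClosed_range.measurableSet

theorem extChartAt_target_subset_closure_interior_self (c : M) :
    (extChartAt I c).target ⊆ closure (interior (extChartAt I c).target) := by
  intro y hy
  rw [extChartAt_target] at hy ⊢
  have hO : IsOpen (I.symm ⁻¹' (chartAt H c).target) :=
    (chartAt H c).open_target.preimage I.continuous_symm
  rw [interior_inter, hO.interior_eq]
  exact hO.inter_closure ⟨hy.1, I.range_subset_closure_interior hy.2⟩

theorem extChartAt_symm_mem_source {c : M} {y : E}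
    (hy : y ∈ (extChartAt I c).target) : (extChartAt I c).symm y ∈ (chartAt H c).source :=
  extChartAt_source I c ▸ (extChartAt I c).map_target hy

end ChartTargets

section Integration

variable {n : ℕ} {H : Type*} [TopologicalSpace H]
  {I : ModelWithCorners ℝ (EuclideanSpace ℝ (Fin n)) H}
  {M : Type*} [TopologicalSpace M] [ChartedSpace H M] [IsManifold I ∞ M] [T2Space M]
  [CompactSpace M]

theorem chartPartition_tsupport_subset (c : M) :
    tsupport (chartPartition I M c) ⊆ (chartAt H c).source :=
  (SmoothPartitionOfUnity.exists_isSubordinate_chartAt_source I M).choose_spec c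

variable (o : ManifoldOrientation I M)

/-- The contribution `± ρ_c η (∂₁, …, ∂ₙ)` of the chart around `c` to the integral of `η`, as a
function on `M`. -/
noncomputable def chartIntegrand (η : DForm I M n) (c x : M) : ℝ :=
  chartSign o c x * chartPartition I M c x * η x (coordFrame I c x)

/-- The integral of `chartIntegrand` in the coordinates of the chart around `c`. -/
noncomputable def chartIntegral (η : DForm I M n) (c : M) : ℝ :=
  ∫ y in (extChartAt I c).target, chartIntegrand o η c ((extChartAt I c).symm y)

theorem integralForm_eq_finsum (η : DForm I M n) :
    integralForm o η = ∑ᶠ c : M, chartIntegral o η c := rfl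

theorem finite_support_chartIntegral (η : DForm I M n) :
    (Function.support (chartIntegral o η)).Finite := by
  refine (chartPartition I M).locallyFinite.finite_nonempty_of_compact.subset fun c hc => ?_
  by_contra hempty
  rw [Set.mem_ofPred_eq, Set.not_nonempty_iff_eq_empty, Function.support_eq_empty_iff] at hempty
  exact hc (by simp [chartIntegral, chartIntegrand, hempty])

theorem continuousOn_chartIntegrand {η : DForm I M n} (hη : IsSmoothForm η) (c : M) :
    ContinuousOn (fun y => chartIntegrand o η c ((extChartAt I c).symm y))
      (extChartAt I c).target := by
  have hsource : ContinuousOn (chartIntegrand o η c) (chartAt H c).source :=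
    ((contMDiffOn_chartSign o c).continuousOn.mul
      (chartPartition I M c).contMDiff.continuous.continuousOn).mul (hη c id).continuousOn
  exact hsource.comp (continuousOn_extChartAt_symm c) fun _ hy => extChartAt_symm_mem_source hy

theorem integrableOn_chartIntegrand {η : DForm I M n} (hη : IsSmoothForm η) (c : M) :
    IntegrableOn (fun y => chartIntegrand o η c ((extChartAt I c).symm y))
      (extChartAt I c).target := by
  have hsub : tsupport (chartPartition I M c) ⊆ (extChartAt I c).source :=
    extChartAt_source I c ▸ chartPartition_tsupport_subset c
  have hK : IsCompact (extChartAt I c '' tsupport (chartPartition I M c)) :=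
    (isClosed_tsupport _).isCompact.image_of_continuousOn ((continuousOn_extChartAt c).mono hsub)
  have hKt : extChartAt I c '' tsupport (chartPartition I M c) ⊆ (extChartAt I c).target :=
    Set.image_subset_iff.mpr fun x hx => (extChartAt I c).map_source (hsub hx)
  refine (((continuousOn_chartIntegrand o hη c).mono hKt).integrableOn_compact hK
    ).of_forall_sdiff_eq_zero (measurableSet_extChartAt_target c) ?_
  rintro y ⟨hy, hyK⟩
  have hρ : chartPartition I M c ((extChartAt I c).symm y) = 0 := by
    by_contra hne
    exact hyK ⟨_, subset_tsupport _ hne, (extChartAt I c).right_inv hy⟩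
  rw [chartIntegrand, hρ, mul_zero, zero_mul]

theorem integralForm_add {η θ : DForm I M n} (hη : IsSmoothForm η) (hθ : IsSmoothForm θ) :
    integralForm o (η + θ) = integralForm o η + integralForm o θ := by
  simp only [integralForm_eq_finsum]
  rw [← finsum_add_distrib (finite_support_chartIntegral o η) (finite_support_chartIntegral o θ)]
  refine finsum_congr fun c => ?_
  rw [chartIntegral, chartIntegral, chartIntegral,
    ← integral_add (integrableOn_chartIntegrand o hη c) (integrableOn_chartIntegrand o hθ c)]
  simp only [chartIntegrand, Pi.add_apply, AlternatingMap.add_apply, mul_add]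

theorem integralForm_smul (r : ℝ) (η : DForm I M n) :
    integralForm o (r • η) = r * integralForm o η := by
  simp only [integralForm_eq_finsum]
  rw [← smul_eq_mul, smul_finsum]
  refine finsum_congr fun c => ?_
  rw [smul_eq_mul, chartIntegral, chartIntegral, ← integral_const_mul]
  simp only [chartIntegrand, Pi.smul_apply, AlternatingMap.smul_apply, smul_eq_mul,
    mul_left_comm _ r]

variable {o}

theorem chartIntegral_eq_zero {η : DForm I M n}
    (hnonneg : ∀ c, ∀ x ∈ (chartAt H c).source, 0 ≤ chartIntegrand o η c x)
    (hint : integralForm o η = 0) (c : M) : chartIntegral o η c = 0 := by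
  have hpos : ∀ c, 0 ≤ chartIntegral o η c := fun c =>
    setIntegral_nonneg (measurableSet_extChartAt_target c) fun _ hy =>
      hnonneg c _ (extChartAt_symm_mem_source hy)
  have hfin := finite_support_chartIntegral o η
  rw [integralForm_eq_finsum, finsum_eq_sum _ hfin,
    Finset.sum_eq_zero_iff_of_nonneg fun c _ => hpos c] at hint
  by_contra hc
  exact hc (hint c (hfin.mem_toFinset.mpr hc))

theorem chartIntegrand_eq_zero {η : DForm I M n} (hη : IsSmoothForm η)
    (hnonneg : ∀ c, ∀ x ∈ (chartAt H c).source, 0 ≤ chartIntegrand o η c x)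
    (hint : integralForm o η = 0) {c x : M} (hx : x ∈ (chartAt H c).source) :
    chartIntegrand o η c x = 0 := by
  have hae := (setIntegral_eq_zero_iff_of_nonneg_ae
    (ae_restrict_of_forall_mem (measurableSet_extChartAt_target c) fun _ hy =>
      hnonneg c _ (extChartAt_symm_mem_source hy))
    (integrableOn_chartIntegrand o hη c)).mp (chartIntegral_eq_zero hnonneg hint c)
  have heqOn := Measure.eqOn_of_ae_eq hae (continuousOn_chartIntegrand o hη c) continuousOn_const
    (extChartAt_target_subset_closure_interior_self c)
  have hx' : x ∈ (extChartAt I c).source := by rwa [extChartAt_source]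
  simpa only [(extChartAt I c).left_inv hx', Pi.zero_apply] using
    heqOn ((extChartAt I c).map_source hx')

variable [RiemannianBundle (fun x : M => TangentSpace I x)]
  [IsContMDiffRiemannianBundle I ∞ (EuclideanSpace ℝ (Fin n)) (fun x : M => TangentSpace I x)]

theorem eq_zero_of_integralForm_fmul_volForm_eq_zero {f : M → ℝ} (hf : ContMDiff I 𝓘(ℝ) ∞ f)
    (hf0 : 0 ≤ f) (hint : integralForm o (fmul f (volForm o)) = 0) : f = 0 := by
  have hval : ∀ c x, chartIntegrand o (fmul f (volForm o)) c x =
      chartPartition I M c x * f x * (chartSign o c x * volForm o x (coordFrame I c x)) := by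
    intro c x
    rw [chartIntegrand, fmul, AlternatingMap.smul_apply, smul_eq_mul]
    ring
  have hnonneg : ∀ c, ∀ x ∈ (chartAt H c).source,
      0 ≤ chartIntegrand o (fmul f (volForm o)) c x := fun c x hx => by
    rw [hval]
    exact mul_nonneg (mul_nonneg ((chartPartition I M).nonneg c x) (hf0 x))
      (chartSign_mul_volForm_pos o hx).le
  funext x
  obtain ⟨c, hc⟩ := (chartPartition I M).exists_pos_of_mem (Set.mem_univ x)
  have hx : x ∈ (chartAt H c).source :=
    chartPartition_tsupport_subset c (subset_tsupport _ hc.ne')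
  have hzero := chartIntegrand_eq_zero ((isSmoothForm_volForm o).fmul hf) hnonneg hint hx
  rwa [hval, mul_eq_zero_iff_right (chartSign_mul_volForm_pos o hx).ne',
    mul_eq_zero_iff_left hc.ne'] at hzero

end Integration

section VariationalDerivative

variable {n : ℕ} {H : Type*} [TopologicalSpace H]
  {I : ModelWithCorners ℝ (EuclideanSpace ℝ (Fin n)) H}
  {M : Type*} [TopologicalSpace M] [ChartedSpace H M] [IsManifold I ∞ M] [T2Space M]
  [CompactSpace M] {o : ManifoldOrientation I M} {k l : ℕ} {h : k + l = n}

theorem IsVariationalDerivative.integralForm_wedge_sub_eq_zero {F : DForm I M k → ℝ}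
    {a : DForm I M k} {e e' : DForm I M l} (he : IsVariationalDerivative o h F a e)
    (he' : IsVariationalDerivative o h F a e') {δ : DForm I M k} (hδ : IsSmoothForm δ) :
    integralForm o (wedge h δ (e - e')) = 0 := by
  have heq := (he.2 δ hδ).unique (he'.2 δ hδ)
  rw [← sub_add_cancel e e', wedge_add_right, integralForm_add o
    (hδ.wedge h (he.1.sub he'.1)) (hδ.wedge h he'.1)] at heq
  exact add_eq_right.mp heq

theorem isVariationalDerivative_integralForm_wedge {e : DForm I M l} (he : IsSmoothForm e)
    {a : DForm I M k} (ha : IsSmoothForm a) :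
    IsVariationalDerivative o h (fun a' => integralForm o (wedge h a' e)) a e := by
  refine ⟨he, fun δ hδ => ?_⟩
  have hexp : ∀ ε : ℝ, integralForm o (wedge h (a + ε • δ) e) =
      integralForm o (wedge h a e) + ε * integralForm o (wedge h δ e) := fun ε => by
    rw [wedge_add_left, integralForm_add o (ha.wedge h he) ((hδ.const_smul ε).wedge h he),
      wedge_smul_left, integralForm_smul]
  simp only [hexp]
  simpa using ((hasDerivAt_id (0 : ℝ)).mul_const (integralForm o (wedge h δ e))).const_add
    (integralForm o (wedge h a e))

variable [RiemannianBundle (fun x : M => TangentSpace I x)]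
  [IsContMDiffRiemannianBundle I ∞ (EuclideanSpace ℝ (Fin n)) (fun x : M => TangentSpace I x)]

theorem IsVariationalDerivative.unique {F : DForm I M k → ℝ} {a : DForm I M k}
    {e e' : DForm I M l} (he : IsVariationalDerivative o h F a e)
    (he' : IsVariationalDerivative o h F a e') : e = e' := by
  have h' : l + k = n := (Nat.add_comm l k).trans h
  have hγ : IsSmoothForm (e - e') := he.1.sub he'.1
  obtain ⟨s, hs⟩ := exists_wedge_comm (I := I) (M := M) h' h
  have hint := he.integralForm_wedge_sub_eq_zero he' (hγ.hodge o h')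
  rw [hs, integralForm_smul, wedge_hodge, mul_eq_zero_iff_left (by simp)] at hint
  exact sub_eq_zero.mp <| formInner_self_eq_zero.mp <|
    eq_zero_of_integralForm_fmul_volForm_eq_zero (contMDiff_formInner hγ hγ)
      (fun x => altInner_self_nonneg _) hint

theorem isVariationalDerivative_integralForm_wedge_hodge {f : M → ℝ}
    (hf : ContMDiff I 𝓘(ℝ) ∞ f) {a : DForm I M k} (ha : IsSmoothForm a) :
    IsVariationalDerivative o h (fun a' => integralForm o (fmul f (wedge h a' (hodge o h a')))) a
      ((2 : ℝ) • fmul f (hodge o h a)) := by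
  refine ⟨((ha.hodge o h).fmul hf).const_smul 2, fun δ hδ => ?_⟩
  let Q (α β : DForm I M k) : DForm I M n := fmul f (wedge h α (hodge o h β))
  have hQ : ∀ {α β : DForm I M k}, IsSmoothForm α → IsSmoothForm β → IsSmoothForm (Q α β) :=
    fun hα hβ => (hα.wedge h (hβ.hodge o h)).fmul hf
  have hpair : wedge h δ ((2 : ℝ) • fmul f (hodge o h a)) = (2 : ℝ) • Q δ a := by
    rw [wedge_smul_right, wedge_fmul_right]
  have hpolar : ∀ ε : ℝ, Q (a + ε • δ) (a + ε • δ) =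
      Q a a + (ε • ((2 : ℝ) • Q δ a) + ε ^ 2 • Q δ δ) := fun ε => by
    funext x
    have hx := altInner_add_smul_self (a x) (δ x) ε
    simp only [Q, wedge_hodge, fmul, formInner, Pi.add_apply, Pi.smul_apply] at hx ⊢
    rw [hx]
    module
  have hexp : ∀ ε : ℝ, integralForm o (Q (a + ε • δ) (a + ε • δ)) =
      integralForm o (Q a a) + (ε * integralForm o ((2 : ℝ) • Q δ a) +
        ε ^ 2 * integralForm o (Q δ δ)) := fun ε => by
    have hlin := ((hQ hδ ha).const_smul 2).const_smul ε
    have hquad := (hQ hδ hδ).const_smul (ε ^ 2)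
    rw [hpolar, integralForm_add o (hQ ha ha) (hlin.add hquad), integralForm_add o hlin hquad,
      integralForm_smul o ε, integralForm_smul o (ε ^ 2)]
  change HasDerivAt (fun ε => integralForm o (Q (a + ε • δ) (a + ε • δ))) _ 0
  simp only [hexp, hpair]
  simpa using (((hasDerivAt_id (0 : ℝ)).mul_const (integralForm o ((2 : ℝ) • Q δ a))).add
    ((hasDerivAt_pow 2 (0 : ℝ)).mul_const (integralForm o (Q δ δ)))).const_add
      (integralForm o (Q a a))

end VariationalDerivative

section KineticEnergy

variable {m : ℕ} {H : Type*} [TopologicalSpace H]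
  {I : ModelWithCorners ℝ (EuclideanSpace ℝ (Fin (m + 1))) H}
  {M : Type*} [TopologicalSpace M] [ChartedSpace H M] [IsManifold I ∞ M]
  [RiemannianBundle (fun x : M => TangentSpace I x)]

theorem bijOn_velocityMap [IsContMDiffRiemannianBundle I ∞ (EuclideanSpace ℝ (Fin (m + 1)))
      (fun x : M => TangentSpace I x)] (o : ManifoldOrientation I M) :
    Set.BijOn (velocityMap o) (kineticStates o) (kineticStates o) := by
  refine Set.BijOn.mk ?mapsTo ?injOn ?surjOn
  case mapsTo =>
    rintro ⟨α, μ⟩ ⟨hα, hμ, h0⟩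
    refine ⟨hα.fmul ?_, hμ, h0⟩
    simp only [one_div]
    exact (contMDiff_density o hμ).inv₀ h0
  case injOn =>
    rintro ⟨α, μ⟩ ⟨-, -, h0⟩ ⟨α', μ'⟩ - heq
    obtain ⟨hvel, rfl⟩ := Prod.ext_iff.mp heq
    exact Prod.ext (funext fun x =>
      smul_right_injective _ (one_div_ne_zero (h0 x)) (congrFun hvel x)) rfl
  case surjOn =>
    rintro ⟨w, μ⟩ ⟨hw, hμ, h0⟩
    refine ⟨(fmul (density o μ) w, μ), ⟨hw.fmul (contMDiff_density o hμ), hμ, h0⟩,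
      Prod.ext (funext fun x => ?_) rfl⟩
    simp only [velocityMap, fmul, smul_smul, one_div_mul_cancel (h0 x), one_smul]

variable [T2Space M] [CompactSpace M] (o : ManifoldOrientation I M)

theorem kineticEnergyMomentum_eq_kineticEnergyVelocity {α : DForm I M 1} {μ : DForm I M (m + 1)}
    (h0 : ∀ x, density o μ x ≠ 0) :
    kineticEnergyMomentum o α μ =
      kineticEnergyVelocity o (fmul (fun x => 1 / density o μ x) α) μ := by
  rw [kineticEnergyMomentum, kineticEnergyVelocity, hodge_fmul, wedge_fmul_left, wedge_fmul_right,
    fmul_fmul, fmul_fmul]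
  congr 2
  funext x
  have hx := h0 x
  simp only [Pi.mul_apply]
  field_simp

theorem kineticEnergyVelocity_eq_integralForm_wedge (w : DForm I M 1) (μ : DForm I M (m + 1)) :
    kineticEnergyVelocity o w μ = integralForm o
      (wedge (Nat.add_zero (m + 1)) μ ((1 / 2 : ℝ) • interiorProduct (sharp w) w)) := by
  rw [kineticEnergyVelocity, ← Pi.mul_def (f := fun _ => (1 / 2 : ℝ)), ← fmul_fmul,
    fmul_density_wedge_hodge, fmul_fmul]
  congr 1
  funext x
  rw [wedge, altWedge_zero_form, Pi.smul_apply, AlternatingMap.smul_apply,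
    interiorProduct_sharp_apply]
  rfl

variable [IsContMDiffRiemannianBundle I ∞ (EuclideanSpace ℝ (Fin (m + 1)))
  (fun x : M => TangentSpace I x)] {w : DForm I M 1} {μ : DForm I M (m + 1)}

theorem isVariationalDerivative_kineticEnergyVelocity_left (hw : IsSmoothForm w)
    (hμ : IsSmoothForm μ) :
    IsVariationalDerivative o (Nat.add_comm 1 m) (fun w' => kineticEnergyVelocity o w' μ) w
      (fmul (density o μ) (hodge o (Nat.add_comm 1 m) w)) := by
  have htwo : (2 : ℝ) • fmul (fun x => 1 / 2 * density o μ x) (hodge o (Nat.add_comm 1 m) w) =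
      fmul (density o μ) (hodge o (Nat.add_comm 1 m) w) := by
    funext x
    simp only [Pi.smul_apply, fmul, smul_smul]
    congr 1
    ring
  exact htwo ▸ isVariationalDerivative_integralForm_wedge_hodge
    (contMDiff_const.mul (contMDiff_density o hμ)) hw

theorem isVariationalDerivative_kineticEnergyVelocity_right (hw : IsSmoothForm w)
    (hμ : IsSmoothForm μ) :
    IsVariationalDerivative o (Nat.add_zero (m + 1)) (fun μ' => kineticEnergyVelocity o w μ') μ
      ((1 / 2 : ℝ) • interiorProduct (sharp w) w) := by
  simp only [kineticEnergyVelocity_eq_integralForm_wedge]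
  exact isVariationalDerivative_integralForm_wedge
    ((isSmoothForm_interiorProduct_sharp_one_form hw hw).const_smul _) hμ

end KineticEnergy

theorem proposition5 {m : ℕ} {H : Type*} [TopologicalSpace H]
    (I : ModelWithCorners ℝ (EuclideanSpace ℝ (Fin (m + 1))) H)
    {M : Type*} [TopologicalSpace M] [T2Space M] [CompactSpace M] [ChartedSpace H M]
    [IsManifold I ∞ M] [RiemannianBundle (fun x : M => TangentSpace I x)]
    [IsContMDiffRiemannianBundle I ∞ (EuclideanSpace ℝ (Fin (m + 1)))
      (fun x : M => TangentSpace I x)]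
    (o : ManifoldOrientation I M) :
    -- the kinetic energy in the velocity variables `(w, μ) = (α / *μ, μ)`
    (Set.BijOn (velocityMap o) (kineticStates o) (kineticStates o) ∧
      ∀ s ∈ kineticStates o, kineticEnergyMomentum o s.1 s.2 =
        kineticEnergyVelocity o (velocityMap o s).1 (velocityMap o s).2) ∧
    -- the variational derivatives
    ∀ (w : DForm I M 1) (μ : DForm I M (m + 1)), IsSmoothForm w → IsSmoothForm μ →
      (∀ e : DForm I M m,
        IsVariationalDerivative o (Nat.add_comm 1 m) (fun w' => kineticEnergyVelocity o w' μ) w e ↔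
          e = fmul (density o μ) (hodge o (Nat.add_comm 1 m) w)) ∧
      fmul (density o μ) (hodge o (Nat.add_comm 1 m) w) = interiorProduct (sharp w) μ ∧
      (∀ e : DForm I M 0,
        IsVariationalDerivative o (Nat.add_zero (m + 1)) (fun μ' => kineticEnergyVelocity o w μ') μ e ↔
          e = (1 / 2 : ℝ) • interiorProduct (sharp w) w) := by
  refine ⟨⟨bijOn_velocityMap o, fun s hs => kineticEnergyMomentum_eq_kineticEnergyVelocity o hs.2.2⟩,
    fun w μ hw hμ => ?_⟩
  have hvelocity := isVariationalDerivative_kineticEnergyVelocity_left o hw hμ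
  have hmass := isVariationalDerivative_kineticEnergyVelocity_right o hw hμ
  exact ⟨fun e => ⟨fun he => he.unique hvelocity, fun he => he ▸ hvelocity⟩,
    fmul_density_hodge o w μ,
    fun e => ⟨fun he => he.unique hmass, fun he => he ▸ hmass⟩⟩
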